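/- For $d\ge 1$ and a law $Q$ on $\mathbb R^d\times\mathbb R^d$, call $Q$ a martingale law if, for $(X',Y')\sim Q$, $Y'$ is integrable and $\mathbb E[Y'|X']=X'$ a.s. For $\gamma\ge1$ let $$\mathcal{AW}_\gamma(P,Q)^\gamma=\inf_\pi \mathbb E_\pi\big[|Y-Y'|_2^\gamma+|X-X'|_2^\gamma\big],$$ where the infimum runs over all bi-causal couplings $\pi$ of $P$ and $Q$, i.e. laws of $(X,Y,X',Y')$ with $(X,Y)\sim P$, $(X',Y')\sim Q$, $\mathrm{Law}(Y|X,X')=\mathrm{Law}(Y|X)$ and $\mathrm{Law}(Y'|X,X')=\mathrm{Law}(Y'|X')$. Put $\mathrm{MPD}(P,\gamma)=\inf\{\mathcal{AW}_\gamma(P,Q)^\gamma: Q \text{ a martingale law}\}$ and $\mathrm{MPD}^{*\xi}(P,\gamma)=\mathrm{MPD}(P^{*\xi},\gamma)$, where $P^{*\xi}$ is the law of $(X+\xi,Y+\xi)$ for $(X,Y)\sim P$ independent of $\xi$. For $\rho>d+1$ and $\sigma>0$, let $\xi$ have the Lebesgue density $$f_{\xi,\rho,\sigma}(x)=\sigma^{-d}C_\rho\Big(\frac{|x|_2}{\sigma}+1\Big)^{-\rho},\qquad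 C_\rho^{-1}=\int_{\mathbb R^d}(|x|_2+1)^{-\rho}\,dx .$$ **Proposition.** There is a universal constant $L>0$ with the following property. Let $d\ge1$, $\rho>d+1$, $\sigma>0$, $p>d+1$ and $1/p+1/q=1$. Let $P_0$ be a martingale law on $\mathbb R^d\times\mathbb R^d$ and $(X,Y)\sim P_0$ with $(X,Y)\in L^{2p}$. Let $n\ge1$, let $(X_1,Y_1),\dots,(X_n,Y_n)$ be i.i.d. with law $P_0$, and let $P_n=\frac1n\sum_{i=1}^n\delta_{(X_i,Y_i)}$ be the empirical measure. Then the smoothed empirical martingale projection distance $\mathrm{MPD}^{*\xi}(P_n,1)$ is a (measurable) random variable and $$\begin{aligned} \mathbb E\big[\mathrm{MPD}^{*\xi}(P_n,1)\big]\le{}& L n^{-1/2}\sum_{j=1}^d\|X^j-Y^j\|_{2p}\,C_\rho\Bigg[d^{3/2}\rho\left(\mathbb E[|X|_2^{2p}]^{1/(2q)}2^{p-1}\frac{\sigma^{-p}}{p-1-d}+2^{\rho+1}\frac{\sigma^{-1}}{\rho+1-d}\right)\\ &+d\left(\mathbb E[|X|_2^{2p}]^{1/(2q)}2^{p-1}\frac{\sigma^{-(p-1)}}{p-1-d}+2^{\rho}\frac{1}{\rho-d}\right)+\big(\sqrt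 d\,\rho\,\sigma^{-(d+1)}+\sigma^{-d}\big)(\sigma^d+1)\Bigg], \end{aligned}$$ where $X^j,Y^j$ are the $j$-th coordinates and $\|Z\|_{2p}=\mathbb E[|Z|^{2p}]^{1/(2p)}$. -/

import Mathlib

open MeasureTheory ProbabilityTheory
open scoped ENNReal

namespace MartProj

noncomputable section

/-- The Euclidean space `ℝ^d` (with the `ℓ²` norm). -/
abbrev Rd (d : ℕ) : Type := EuclideanSpace ℝ (Fin d)

/-- A coupling `π = Law((X, Y), (X', Y'))` of `P` and `Q` is bi-causal if
`Law(Y | X, X') = Law(Y | X)` and `Law(Y' | X, X') = Law(Y' | X')`,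
the conditional laws being regular conditional distributions. -/
structure IsBicausalCoupling {d : ℕ} (P Q : Measure (Rd d × Rd d))
    (π : Measure ((Rd d × Rd d) × (Rd d × Rd d))) [IsProbabilityMeasure π] : Prop where
  map_fst : π.map Prod.fst = P
  map_snd : π.map Prod.snd = Q
  causal : ∀ᵐ z ∂π,
    condDistrib (fun z => z.1.2) (fun z => (z.1.1, z.2.1)) π (z.1.1, z.2.1)
      = condDistrib (fun z => z.1.2) (fun z => z.1.1) π z.1.1
  anticausal : ∀ᵐ z ∂π,
    condDistrib (fun z => z.2.2) (fun z => (z.1.1, z.2.1)) π (z.1.1, z.2.1)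
      = condDistrib (fun z => z.2.2) (fun z => z.2.1) π z.2.1

/-- The adapted (bi-causal) Wasserstein distance
`AW_γ(P, Q) = (inf_π E_π[|Y - Y'|^γ + |X - X'|^γ])^{1/γ}`, with values in `[0, ∞]`. -/
def adaptedWasserstein {d : ℕ} (γ : ℝ) (P Q : Measure (Rd d × Rd d)) : ℝ≥0∞ :=
  (⨅ (π : Measure ((Rd d × Rd d) × (Rd d × Rd d))) (_ : IsProbabilityMeasure π)
    (_ : IsBicausalCoupling P Q π),
      ∫⁻ z, (‖z.1.2 - z.2.2‖ₑ ^ γ + ‖z.1.1 - z.2.1‖ₑ ^ γ) ∂π) ^ (1 / γ)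

/-- `Q = Law(X, Y)` is a martingale law: `Y` is integrable and `E[Y | X] = X` almost surely. -/
structure IsMartingaleLaw {d : ℕ} (Q : Measure (Rd d × Rd d)) : Prop where
  isProbabilityMeasure : IsProbabilityMeasure Q
  integrable : Integrable (fun z : Rd d × Rd d => z.2) Q
  condExp_eq : Q[fun z : Rd d × Rd d => z.2 |
    MeasurableSpace.comap (fun z : Rd d × Rd d => z.1) inferInstance] =ᵐ[Q] fun z => z.1

/-- The martingale projection distance
`MPD(P, γ) = inf {AW_γ(P, Q)^γ : Q a martingale law}`. -/
def mpd {d : ℕ} (P : Measure (Rd d × Rd d)) (γ : ℝ) : ℝ≥0∞ :=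
  ⨅ (Q : Measure (Rd d × Rd d)) (_ : IsMartingaleLaw Q), adaptedWasserstein γ P Q ^ γ

/-- The smoothed law `P^{*ξ} = Law(X + ξ, Y + ξ)`, where `(X, Y, ξ) ∼ P ⊗ P_ξ`. -/
def smoothedLaw {d : ℕ} (Pξ : Measure (Rd d)) (P : Measure (Rd d × Rd d)) :
    Measure (Rd d × Rd d) :=
  (P.prod Pξ).map fun z => (z.1.1 + z.2, z.1.2 + z.2)

/-- The smoothed martingale projection distance `MPD^{*ξ}(P, γ) = MPD(P^{*ξ}, γ)`. -/
def smoothedMPD {d : ℕ} (Pξ : Measure (Rd d)) (P : Measure (Rd d × Rd d)) (γ : ℝ) : ℝ≥0∞ :=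
  mpd (smoothedLaw Pξ P) γ

/-- The normalizing constant `C_ρ = (∫_{ℝ^d} (|x| + 1)^{-ρ} dx)⁻¹`. -/
def normConst (d : ℕ) (ρ : ℝ) : ℝ :=
  (∫ x : Rd d, (‖x‖ + 1) ^ (-ρ))⁻¹

/-- The smoothing density `f_{ξ,ρ,σ}(x) = σ^{-d} C_ρ (|x|/σ + 1)^{-ρ}`. -/
def kernelDensity (d : ℕ) (ρ σ : ℝ) (x : Rd d) : ℝ :=
  σ ^ (-(d : ℝ)) * normConst d ρ * (‖x‖ / σ + 1) ^ (-ρ)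

/-- The smoothing law on `ℝ^d` with Lebesgue density `f_{ξ,ρ,σ}`. -/
def kernelLaw (d : ℕ) (ρ σ : ℝ) : Measure (Rd d) :=
  volume.withDensity fun x => ENNReal.ofReal (kernelDensity d ρ σ x)

/-- The empirical measure `(1/n) ∑ᵢ δ_{(xᵢ, yᵢ)}`. -/
def empiricalMeasure {d n : ℕ} (x y : Fin n → Rd d) : Measure (Rd d × Rd d) :=
  (n : ℝ≥0∞)⁻¹ • ∑ i, Measure.dirac (x i, y i)

end

end MartProj

/-! For `γ = 1` the projection distance is explicit: it equals `E|E[Y|X] - X|` (`mpd_one_eq`). The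
upper bound comes from subtracting the conditional bias from `Y`. The lower bound comes from
bi-causality, which lets both martingale defects be conditioned on `(X, X')`, followed by the `L¹`
contraction of conditional expectation.

Under the smoothed empirical measure, the law of `X + ξ` has density `n⁻¹ ∑ f(u - Xᵢ)`, and the bias
at `u` is the average of the `Yᵢ - Xᵢ` with weights `f(u - Xᵢ)`. The density cancels the
denominator, so the distance is `∫ |n⁻¹ ∑ f(u - Xᵢ)(Yᵢ - Xᵢ)| du` (`smoothedMPD_empiricalMeasure`).

For fixed `u`, each coordinate of this sum is an average of centered i.i.d. variables, by the
martingale property of `P₀`. Its mean absolute value is at most `n^{-1/2}` times an `L²` norm, which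
Hölder splits into `‖X^j - Y^j‖_{2p}` and `‖f(u - X)‖_{2q}`. The last factor has a radial majorant
in `u` (`rpow_integral_kernelDensity_le`), integrable since `ρ > d` and `p - 1 > d`. Its integral
carries the volume of the unit ball, which is bounded over all dimensions; that bound is `L`. -/

namespace MartProj

/-! ### Conditional laws and conditional expectations -/

section Conditioning

variable {Ω Ω' β E : Type*}

/-- Conditioning on a pair whose components agree almost surely is conditioning on one of them. -/
lemma condDistrib_prodMk_ae_eq_of_ae_eq {mΩ : MeasurableSpace Ω} [MeasurableSpace β]
    [MeasurableSpace E] [StandardBorelSpace E] [Nonempty E]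
    {μ : Measure Ω} [IsFiniteMeasure μ] {Y : Ω → E} {U V : Ω → β} (hY : Measurable Y)
    (hU : Measurable U) (h : V =ᵐ[μ] U) :
    ∀ᵐ ω ∂μ, condDistrib Y (fun ω => (U ω, V ω)) μ (U ω, V ω) = condDistrib Y U μ (U ω) := by
  have hUV : (fun ω => (U ω, V ω)) =ᵐ[μ] fun ω => (U ω, U ω) := by
    filter_upwards [h] with ω hω
    rw [hω]
  have hdiag : Measurable (fun u : β => (u, u)) := by fun_prop
  -- Disintegrations are a.e. unique, so it suffices that the kernel ignoring the second component
  -- reproduces the joint law; this is checked by pulling sets back along the diagonal.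
  have key : condDistrib Y (fun ω => (U ω, U ω)) μ =ᵐ[μ.map fun ω => (U ω, U ω)]
      Kernel.prodMkRight β (condDistrib Y U μ) := by
    refine condDistrib_ae_eq_of_measure_eq_compProd _ hY.aemeasurable ?_
    have hmap : μ.map (fun ω => (U ω, U ω)) = (μ.map U).map fun u => (u, u) := by
      rw [Measure.map_map hdiag hU]; rfl
    ext s hs
    have hs' : MeasurableSet {x : β × E | ((x.1, x.1), x.2) ∈ s} :=
      hs.preimage (by fun_prop)
    rw [Measure.compProd_apply hs, hmap, lintegral_map (Kernel.measurable_kernel_prodMk_left hs)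
      hdiag, Measure.map_apply (by fun_prop) hs]
    have h1 : (μ.map U ⊗ₘ condDistrib Y U μ) {x : β × E | ((x.1, x.1), x.2) ∈ s} =
        (μ.map fun ω => (U ω, Y ω)) {x : β × E | ((x.1, x.1), x.2) ∈ s} := by
      rw [compProd_map_condDistrib hY.aemeasurable]
    rw [Measure.compProd_apply hs', Measure.map_apply (hU.prodMk hY) hs'] at h1
    exact h1.symm
  have key' := ae_of_ae_map (by fun_prop) key
  rw [condDistrib_congr_right hUV]
  filter_upwards [key', hUV] with ω h1 h2
  rw [h2, h1]
  rfl

/-- Conditional expectations commute with measure preserving maps. -/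
lemma condExp_comp_ae_eq [NormedAddCommGroup E] [NormedSpace ℝ E] [CompleteSpace E]
    {mΩ : MeasurableSpace Ω} {m mΩ' : MeasurableSpace Ω'} (hm : m ≤ mΩ') {μ : Measure Ω} [IsFiniteMeasure μ] {T : Ω → Ω'}
    (hT : Measurable T) {f : Ω' → E} (hf : Integrable f (μ.map T)) :
    (fun ω => ((μ.map T)[f | m]) (T ω)) =ᵐ[μ] μ[fun ω => f (T ω) | m.comap T] := by
  have hle : m.comap T ≤ mΩ := (MeasurableSpace.comap_mono hm).trans (hT.comap_le)
  have hc : Integrable ((μ.map T)[f | m]) (μ.map T) := integrable_condExp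
  refine ae_eq_condExp_of_forall_setIntegral_eq hle (hf.comp_measurable hT)
    (fun _ _ _ => (hc.comp_measurable hT).integrableOn) ?_ ?_
  · rintro s ⟨t, ht, rfl⟩ -
    rw [← setIntegral_map (hm t ht) hc.aestronglyMeasurable hT.aemeasurable,
      ← setIntegral_map (hm t ht) hf.aestronglyMeasurable hT.aemeasurable,
      setIntegral_condExp hm hf ht]
  · refine StronglyMeasurable.aestronglyMeasurable ?_
    exact stronglyMeasurable_condExp.comp_measurable (comap_measurable T)

lemma lintegral_enorm_condExp_le [NormedAddCommGroup E] [NormedSpace ℝ E] [CompleteSpace E]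
    {m mΩ : MeasurableSpace Ω} (hm : m ≤ mΩ) {μ : Measure Ω} [IsFiniteMeasure μ] {f : Ω → E}
    (hf : Integrable f μ) : ∫⁻ ω, ‖(μ[f | m]) ω‖ₑ ∂μ ≤ ∫⁻ ω, ‖f ω‖ₑ ∂μ := by
  rw [← ofReal_integral_norm_eq_lintegral_enorm integrable_condExp,
    ← ofReal_integral_norm_eq_lintegral_enorm hf,
    ← integral_condExp hm (f := fun ω => ‖f ω‖) (μ := μ)]
  exact ENNReal.ofReal_le_ofReal
    (integral_mono_ae integrable_condExp.norm integrable_condExp (norm_condExp_le f))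

/-- `G` is the conditional expectation of `(Y - Y') - (X - X')`, so the bound is the `L¹`
contraction followed by the triangle inequality. -/
lemma lintegral_enorm_le_of_condExp_eq [NormedAddCommGroup E] [NormedSpace ℝ E] [CompleteSpace E]
    {m mΩ : MeasurableSpace Ω} (hm : m ≤ mΩ) {μ : Measure Ω} [IsFiniteMeasure μ]
    {X Y X' Y' G : Ω → E} (hX : Integrable X μ) (hY : Integrable Y μ) (hX' : Integrable X' μ)
    (hY' : Integrable Y' μ) (hmX : StronglyMeasurable[m] X) (hmX' : StronglyMeasurable[m] X')
    (h : μ[Y | m] =ᵐ[μ] fun ω => X ω + G ω) (h' : μ[Y' | m] =ᵐ[μ] X') :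
    ∫⁻ ω, ‖G ω‖ₑ ∂μ ≤ ∫⁻ ω, (‖Y ω - Y' ω‖ₑ + ‖X ω - X' ω‖ₑ) ∂μ := by
  have e : μ[(Y - Y') - (X - X') | m] =ᵐ[μ] G := by
    filter_upwards [condExp_sub (hY.sub hY') (hX.sub hX') m, condExp_sub hY hY' m, h, h']
      with z h1 h2 e1 e2
    rw [h1, Pi.sub_apply, h2, Pi.sub_apply, e1, e2,
      condExp_of_stronglyMeasurable hm (hmX.sub hmX') (hX.sub hX'), Pi.sub_apply]
    abel
  calc ∫⁻ ω, ‖G ω‖ₑ ∂μ = ∫⁻ ω, ‖(μ[(Y - Y') - (X - X') | m]) ω‖ₑ ∂μ :=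
        lintegral_congr_ae (e.symm.fun_comp _)
    _ ≤ ∫⁻ ω, ‖((Y - Y') - (X - X')) ω‖ₑ ∂μ :=
        lintegral_enorm_condExp_le hm ((hY.sub hY').sub (hX.sub hX'))
    _ ≤ _ := lintegral_mono fun z => enorm_sub_le

end Conditioning

/-! ### The martingale projection distance for `γ = 1` -/

section Projection

/-- The σ-algebra generated by the first component. -/
abbrev fstAlgebra (d : ℕ) : MeasurableSpace (Rd d × Rd d) :=
  MeasurableSpace.comap (fun z : Rd d × Rd d => z.1) inferInstance

/-- The σ-algebra generated by `(X, X')`, on the space of `((X, Y), (X', Y'))`. -/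
abbrev fstPairAlgebra (d : ℕ) : MeasurableSpace ((Rd d × Rd d) × (Rd d × Rd d)) :=
  MeasurableSpace.comap (fun z : (Rd d × Rd d) × (Rd d × Rd d) => (z.1.1, z.2.1)) inferInstance

variable {d : ℕ}

lemma adaptedWasserstein_one (P Q : Measure (Rd d × Rd d)) :
    adaptedWasserstein 1 P Q =
      ⨅ (π : Measure ((Rd d × Rd d) × (Rd d × Rd d))) (_ : IsProbabilityMeasure π)
        (_ : IsBicausalCoupling P Q π), ∫⁻ z, (‖z.1.2 - z.2.2‖ₑ + ‖z.1.1 - z.2.1‖ₑ) ∂π := by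
  simp [adaptedWasserstein]

/-- The competitor is `Law(X, Y - g(X))`, coupled to `P` through the same sample point. The two
first components then coincide, so bi-causality is automatic, and the cost is `E|g(X)|`. -/
lemma mpd_one_le {P : Measure (Rd d × Rd d)} [IsProbabilityMeasure P]
    (h1 : Integrable (fun z : Rd d × Rd d => z.1) P)
    (h2 : Integrable (fun z : Rd d × Rd d => z.2) P) {g : Rd d → Rd d} (hg : Measurable g)
    (h : P[fun z : Rd d × Rd d => z.2 | fstAlgebra d] =ᵐ[P]
        fun z => z.1 + g z.1) :
    mpd P 1 ≤ ∫⁻ z, ‖g z.1‖ₑ ∂P := by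
  have hFle : fstAlgebra d ≤ Prod.instMeasurableSpace := measurable_fst.comap_le
  have hgi : Integrable (fun z : Rd d × Rd d => g z.1) P := by
    refine ((integrable_condExp (m := fstAlgebra d) (f := fun z : Rd d × Rd d => z.2)).sub h1).congr ?_
    filter_upwards [h] with z hz
    simp [hz]
  let T : Rd d × Rd d → Rd d × Rd d := fun z => (z.1, z.2 - g z.1)
  have hT : Measurable T := by fun_prop
  have hQi : Integrable (fun z : Rd d × Rd d => z.2) (P.map T) :=
    (integrable_map_measure (by fun_prop) hT.aemeasurable).2 (h2.sub hgi)
  have hQ : IsMartingaleLaw (P.map T) := by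
    refine ⟨Measure.isProbabilityMeasure_map hT.aemeasurable, hQi, ?_⟩
    refine (ae_map_iff hT.aemeasurable (measurableSet_eq_fun
      ((stronglyMeasurable_condExp.mono hFle).measurable) measurable_fst)).2 ?_
    have h3 := condExp_comp_ae_eq hFle hT hQi
    -- `T` fixes the first component, so conditioning on it means the same before and after `T`.
    have h4 : (fstAlgebra d).comap T = fstAlgebra d := by
      rw [fstAlgebra, MeasurableSpace.comap_comp]; rfl
    rw [h4] at h3
    have h5 : P[fun z : Rd d × Rd d => g z.1 | fstAlgebra d] = fun z => g z.1 :=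
      condExp_of_stronglyMeasurable hFle
        (hg.stronglyMeasurable.comp_measurable (comap_measurable _)) hgi
    filter_upwards [h3, condExp_sub h2 hgi (fstAlgebra d), h] with z h3 h6 h
    rw [h3]
    refine h6.trans ?_
    simp [h, h5, T]
  let D : Rd d × Rd d → (Rd d × Rd d) × (Rd d × Rd d) := fun z => (z, T z)
  have hD : Measurable D := by fun_prop
  have hπ : IsProbabilityMeasure (P.map D) := Measure.isProbabilityMeasure_map hD.aemeasurable
  have hdiag : (fun z : (Rd d × Rd d) × (Rd d × Rd d) => z.2.1) =ᵐ[P.map D] fun z => z.1.1 :=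
    (ae_map_iff hD.aemeasurable (measurableSet_eq_fun (by fun_prop) (by fun_prop))).2
      (Filter.Eventually.of_forall fun z => rfl)
  have hbc : IsBicausalCoupling P (P.map T) (P.map D) := by
    refine ⟨?_, ?_, ?_, ?_⟩
    · rw [Measure.map_map measurable_fst hD]
      exact Measure.map_id
    · rw [Measure.map_map measurable_snd hD]
      rfl
    · exact condDistrib_prodMk_ae_eq_of_ae_eq (by fun_prop) (by fun_prop) hdiag
    · rw [condDistrib_congr_right hdiag]
      filter_upwards [condDistrib_prodMk_ae_eq_of_ae_eq
        (Y := fun z : (Rd d × Rd d) × (Rd d × Rd d) => z.2.2) (by fun_prop) (by fun_prop) hdiag,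
        hdiag] with z h1 h2
      rw [h1, h2]
  unfold mpd
  refine (iInf₂_le (P.map T) hQ).trans ?_
  rw [ENNReal.rpow_one, adaptedWasserstein_one]
  refine (iInf₂_le (P.map D) hπ).trans ((iInf_le _ hbc).trans ?_)
  rw [lintegral_map (by fun_prop) hD]
  simp [D, T]

lemma IsMartingaleLaw.integrable_fst {Q : Measure (Rd d × Rd d)} (hQ : IsMartingaleLaw Q) :
    Integrable (fun z : Rd d × Rd d => z.1) Q :=
  integrable_condExp.congr hQ.condExp_eq

/-- Under a bi-causal coupling, adding `X'` to the conditioning on `X` does not change the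
conditional mean of `Y`, and symmetrically for `Y'`. Both identities thus hold given the common
`σ`-algebra of `(X, X')`, where they can be subtracted. -/
lemma le_mpd_one {P : Measure (Rd d × Rd d)} [IsProbabilityMeasure P]
    (h1 : Integrable (fun z : Rd d × Rd d => z.1) P)
    (h2 : Integrable (fun z : Rd d × Rd d => z.2) P) {g : Rd d → Rd d} (hg : Measurable g)
    (h : P[fun z : Rd d × Rd d => z.2 | fstAlgebra d] =ᵐ[P]
        fun z => z.1 + g z.1) :
    ∫⁻ z, ‖g z.1‖ₑ ∂P ≤ mpd P 1 := by
  unfold mpd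
  refine le_iInf₂ fun Q hQ => ?_
  rw [ENNReal.rpow_one, adaptedWasserstein_one]
  refine le_iInf₂ fun π hπ => le_iInf fun hb => ?_
  have hP := hb.map_fst
  have hQm := hb.map_snd
  subst hP
  subst hQm
  have hmf : Measurable (Prod.fst : (Rd d × Rd d) × (Rd d × Rd d) → Rd d × Rd d) :=
    measurable_fst
  have hms : Measurable (Prod.snd : (Rd d × Rd d) × (Rd d × Rd d) → Rd d × Rd d) :=
    measurable_snd
  have i11 := h1.comp_measurable hmf
  have i12 := h2.comp_measurable hmf
  have i21 := hQ.integrable_fst.comp_measurable hms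
  have i22 := hQ.integrable.comp_measurable hms
  simp only [Function.comp_def] at i11 i12 i21 i22
  have c1 : π[fun z => z.1.2 | MeasurableSpace.comap
      (fun z : (Rd d × Rd d) × (Rd d × Rd d) => z.1.1) inferInstance] =ᵐ[π]
        fun z => z.1.1 + g z.1.1 := by
    have := condExp_comp_ae_eq measurable_fst.comap_le hmf h2
    rw [MeasurableSpace.comap_comp] at this
    exact this.symm.trans (ae_of_ae_map hmf.aemeasurable h)
  have c2 : π[fun z => z.2.2 | MeasurableSpace.comap
      (fun z : (Rd d × Rd d) × (Rd d × Rd d) => z.2.1) inferInstance] =ᵐ[π] fun z => z.2.1 := by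
    have := condExp_comp_ae_eq measurable_fst.comap_le hms hQ.integrable
    rw [MeasurableSpace.comap_comp] at this
    exact this.symm.trans (ae_of_ae_map hms.aemeasurable hQ.condExp_eq)
  have hGm : Measurable (fun z : (Rd d × Rd d) × (Rd d × Rd d) => (z.1.1, z.2.1)) := by fun_prop
  have hGle : fstPairAlgebra d ≤ Prod.instMeasurableSpace := hGm.comap_le
  have e1 : π[fun z => z.1.2 | fstPairAlgebra d] =ᵐ[π] fun z => z.1.1 + g z.1.1 := by
    refine (condExp_ae_eq_integral_condDistrib' hGm i12).trans ?_
    refine Filter.EventuallyEq.trans ?_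
      ((condExp_ae_eq_integral_condDistrib' (by fun_prop) i12).symm.trans c1)
    filter_upwards [hb.causal] with z hz
    rw [hz]
  have e2 : π[fun z => z.2.2 | fstPairAlgebra d] =ᵐ[π] fun z => z.2.1 := by
    refine (condExp_ae_eq_integral_condDistrib' hGm i22).trans ?_
    refine Filter.EventuallyEq.trans ?_
      ((condExp_ae_eq_integral_condDistrib' (by fun_prop) i22).symm.trans c2)
    filter_upwards [hb.anticausal] with z hz
    rw [hz]
  rw [lintegral_map (by fun_prop) hmf]
  have hcm : Measurable[fstPairAlgebra d]
      (fun z : (Rd d × Rd d) × (Rd d × Rd d) => (z.1.1, z.2.1)) := comap_measurable _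
  exact lintegral_enorm_le_of_condExp_eq hGle i11 i12 i21 i22
    hcm.fst.stronglyMeasurable hcm.snd.stronglyMeasurable e1 e2

/-- For `γ = 1` the martingale projection distance is `E|E[Y | X] - X|`. -/
theorem mpd_one_eq {P : Measure (Rd d × Rd d)} [IsProbabilityMeasure P]
    (h1 : Integrable (fun z : Rd d × Rd d => z.1) P)
    (h2 : Integrable (fun z : Rd d × Rd d => z.2) P) {g : Rd d → Rd d} (hg : Measurable g)
    (h : P[fun z : Rd d × Rd d => z.2 | fstAlgebra d] =ᵐ[P]
        fun z => z.1 + g z.1) :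
    mpd P 1 = ∫⁻ z, ‖g z.1‖ₑ ∂P :=
  le_antisymm (mpd_one_le h1 h2 hg h) (le_mpd_one h1 h2 hg h)

end Projection

/-! ### The smoothed empirical measure -/

section Smoothing

variable {d n : ℕ}

lemma smoothedLaw_empiricalMeasure (Pξ : Measure (Rd d)) [SFinite Pξ] (x y : Fin n → Rd d) :
    smoothedLaw Pξ (empiricalMeasure x y) =
      (n : ℝ≥0∞)⁻¹ • ∑ i, Pξ.map fun t => (x i + t, y i + t) := by
  ext s hs
  have hT : Measurable fun z : (Rd d × Rd d) × Rd d => (z.1.1 + z.2, z.1.2 + z.2) := by fun_prop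
  rw [smoothedLaw, Measure.map_apply hT hs, Measure.prod_apply (hT hs), empiricalMeasure,
    lintegral_smul_measure, lintegral_finsetSum_measure, Measure.smul_apply,
    Measure.finsetSum_apply]
  congr 1
  refine Finset.sum_congr rfl fun i _ => ?_
  rw [lintegral_dirac' _ (measurable_measure_prodMk_left (hT hs)),
    Measure.map_apply (by fun_prop) hs]
  rfl

lemma isProbabilityMeasure_smoothedLaw_empiricalMeasure (hn : 1 ≤ n) (Pξ : Measure (Rd d))
    [IsProbabilityMeasure Pξ] (x y : Fin n → Rd d) :
    IsProbabilityMeasure (smoothedLaw Pξ (empiricalMeasure x y)) := by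
  constructor
  have h : ∀ i, (Pξ.map fun t => (x i + t, y i + t)) Set.univ = 1 := fun i => by
    rw [Measure.map_apply (by fun_prop) MeasurableSet.univ]; simp
  rw [smoothedLaw_empiricalMeasure, Measure.smul_apply, Measure.finsetSum_apply]
  simp only [h, Finset.sum_const, Finset.card_univ, Fintype.card_fin, nsmul_eq_mul, mul_one,
    smul_eq_mul]
  exact ENNReal.inv_mul_cancel (by simp; omega) (by simp)

lemma lintegral_smoothedLaw_empiricalMeasure {f : Rd d → ℝ} (hf : Measurable f)
    (x y : Fin n → Rd d) {F : Rd d → ℝ≥0∞} (hF : Measurable F) :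
    ∫⁻ z, F z.1 ∂smoothedLaw (volume.withDensity fun u => ENNReal.ofReal (f u))
      (empiricalMeasure x y) =
      (n : ℝ≥0∞)⁻¹ * ∑ i, ∫⁻ u, ENNReal.ofReal (f (u - x i)) * F u := by
  rw [smoothedLaw_empiricalMeasure, lintegral_smul_measure, lintegral_finsetSum_measure,
    smul_eq_mul]
  congr 1
  refine Finset.sum_congr rfl fun i _ => ?_
  rw [lintegral_map (by fun_prop) (by fun_prop),
    lintegral_withDensity_eq_lintegral_mul _ (by fun_prop) (by fun_prop),
    ← lintegral_add_left_eq_self (fun u => ENNReal.ofReal (f (u - x i)) * F u) (x i)]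
  simp

lemma integrable_withDensity_comp_add_left {f : Rd d → ℝ} (hf : Measurable f)
    (hf0 : ∀ u, 0 ≤ f u) (a : Rd d) {F : Rd d → Rd d} (hF : Measurable F) :
    Integrable (fun t => F (a + t)) (volume.withDensity fun u => ENNReal.ofReal (f u)) ↔
      Integrable fun u => f (u - a) • F u := by
  rw [integrable_withDensity_iff_integrable_smul' (by fun_prop) (by simp),
    ← (measurePreserving_add_left volume a).integrable_comp (g := fun u => f (u - a) • F u)
      (by fun_prop)]
  simp [Function.comp_def, hf0]

lemma integral_withDensity_comp_add_left {f : Rd d → ℝ} (hf : Measurable f)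
    (hf0 : ∀ u, 0 ≤ f u) (a : Rd d) (F : Rd d → Rd d) :
    ∫ t, F (a + t) ∂(volume.withDensity fun u => ENNReal.ofReal (f u)) =
      ∫ u, f (u - a) • F u := by
  rw [integral_withDensity_eq_integral_toReal_smul (by fun_prop) (by simp),
    ← integral_add_left_eq_self (fun u => f (u - a) • F u) a]
  simp [hf0]

lemma integrable_smoothedLaw_empiricalMeasure (hn : 1 ≤ n) {Pξ : Measure (Rd d)} [SFinite Pξ]
    (x y : Fin n → Rd d) {F : Rd d × Rd d → Rd d} (hF : Measurable F)
    (h : ∀ i, Integrable (fun t => F (x i + t, y i + t)) Pξ) :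
    Integrable F (smoothedLaw Pξ (empiricalMeasure x y)) := by
  rw [smoothedLaw_empiricalMeasure]
  refine Integrable.smul_measure (integrable_finsetSum_measure.2 fun i _ => ?_) (by simp; omega)
  exact (integrable_map_measure (by fun_prop) (by fun_prop)).2 (h i)

lemma integral_smoothedLaw_empiricalMeasure {Pξ : Measure (Rd d)} [SFinite Pξ]
    (x y : Fin n → Rd d) {F : Rd d × Rd d → Rd d} (hF : Measurable F)
    (h : ∀ i, Integrable (fun t => F (x i + t, y i + t)) Pξ) :
    ∫ z, F z ∂smoothedLaw Pξ (empiricalMeasure x y) =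
      (n : ℝ)⁻¹ • ∑ i, ∫ t, F (x i + t, y i + t) ∂Pξ := by
  rw [smoothedLaw_empiricalMeasure, integral_smul_measure, integral_finsetSum_measure]
  · simp only [ENNReal.toReal_inv, ENNReal.toReal_natCast]
    congr 1
    refine Finset.sum_congr rfl fun i _ => ?_
    rw [integral_map (by fun_prop) (by fun_prop)]
  · exact fun i _ => (integrable_map_measure (by fun_prop) (by fun_prop)).2 (h i)

/-- The regression function of `Y - X` on `X` under the smoothed empirical measure. -/
noncomputable def regression (f : Rd d → ℝ) (x y : Fin n → Rd d) (u : Rd d) : Rd d :=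
  (∑ i, f (u - x i))⁻¹ • ∑ i, f (u - x i) • (y i - x i)

lemma measurable_regression {f : Rd d → ℝ} (hf : Measurable f) (x y : Fin n → Rd d) :
    Measurable (regression f x y) := by
  unfold regression
  fun_prop

lemma sum_density_pos (hn : 1 ≤ n) {f : Rd d → ℝ} (hf0 : ∀ u, 0 < f u) (x : Fin n → Rd d)
    (u : Rd d) : 0 < ∑ i, f (u - x i) :=
  have : Nonempty (Fin n) := ⟨⟨0, hn⟩⟩
  Finset.sum_pos (fun _ _ => hf0 _) Finset.univ_nonempty

lemma sum_smul_regression (hn : 1 ≤ n) {f : Rd d → ℝ} (hf0 : ∀ u, 0 < f u)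
    (x y : Fin n → Rd d) (u : Rd d) :
    (∑ i, f (u - x i)) • regression f x y u = ∑ i, f (u - x i) • (y i - x i) :=
  smul_inv_smul₀ (sum_density_pos hn hf0 x u).ne' _

/-- The regression function is a convex combination of the `y i - x i`; boundedness makes it
integrable under every shift of the noise. -/
lemma norm_regression_le (hn : 1 ≤ n) {f : Rd d → ℝ} (hf0 : ∀ u, 0 < f u)
    (x y : Fin n → Rd d) (u : Rd d) : ‖regression f x y u‖ ≤ ∑ i, ‖y i - x i‖ := by
  have hk := sum_density_pos hn hf0 x u
  rw [regression, norm_smul, norm_inv, Real.norm_of_nonneg hk.le, inv_mul_le_iff₀ hk,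
    Finset.sum_mul]
  refine (norm_sum_le _ _).trans (Finset.sum_le_sum fun i _ => ?_)
  rw [norm_smul, Real.norm_of_nonneg (hf0 _).le]
  exact mul_le_mul_of_nonneg_left
    (Finset.single_le_sum (f := fun i => ‖y i - x i‖) (fun _ _ => norm_nonneg _)
      (Finset.mem_univ i)) (hf0 _).le

/-- Integrating the norm of the regression function against the density of `X + ξ` cancels the
normalizing sum, which leaves a plain Lebesgue integral. -/
theorem smoothedMPD_empiricalMeasure (hn : 1 ≤ n) {f : Rd d → ℝ} (hf : Measurable f)
    (hf0 : ∀ u, 0 < f u) [hp : IsProbabilityMeasure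
      (volume.withDensity fun u : Rd d => ENNReal.ofReal (f u))]
    (hint : Integrable (fun u => u) (volume.withDensity fun u : Rd d => ENNReal.ofReal (f u)))
    (x y : Fin n → Rd d) :
    smoothedMPD (volume.withDensity fun u => ENNReal.ofReal (f u)) (empiricalMeasure x y) 1 =
      ∫⁻ u, ‖(n : ℝ)⁻¹ • ∑ i, f (u - x i) • (y i - x i)‖ₑ := by
  set Pξ := volume.withDensity fun u : Rd d => ENNReal.ofReal (f u) with hPξ
  have hP := isProbabilityMeasure_smoothedLaw_empiricalMeasure hn Pξ x y
  have hg := measurable_regression hf x y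
  have hadd : ∀ a : Rd d, Integrable (fun t => a + t) Pξ := fun a =>
    (integrable_const a).add hint
  have h1 : Integrable (fun z : Rd d × Rd d => z.1) (smoothedLaw Pξ (empiricalMeasure x y)) :=
    integrable_smoothedLaw_empiricalMeasure hn x y (by fun_prop) fun i => hadd _
  have h2 : Integrable (fun z : Rd d × Rd d => z.2) (smoothedLaw Pξ (empiricalMeasure x y)) :=
    integrable_smoothedLaw_empiricalMeasure hn x y (by fun_prop) fun i => hadd _
  have hgi : ∀ i, Integrable (fun t => regression f x y (x i + t)) Pξ := fun i =>
    Integrable.of_bound (hg.comp (measurable_const_add _)).aestronglyMeasurable _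
      (Filter.Eventually.of_forall fun t => norm_regression_le hn hf0 x y _)
  have h3 : Integrable (fun z : Rd d × Rd d => regression f x y z.1)
      (smoothedLaw Pξ (empiricalMeasure x y)) :=
    integrable_smoothedLaw_empiricalMeasure hn x y (by fun_prop) hgi
  rw [smoothedMPD, mpd_one_eq h1 h2 hg,
    lintegral_smoothedLaw_empiricalMeasure hf x y (F := fun u => ‖regression f x y u‖ₑ) hg.enorm,
    ← lintegral_finsetSum _ (by fun_prop), ← lintegral_const_mul _ (by fun_prop)]
  · refine lintegral_congr fun u => ?_
    rw [← Finset.sum_mul, ← ENNReal.ofReal_sum_of_nonneg fun i _ => (hf0 _).le,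
      ← sum_smul_regression hn hf0, enorm_smul, enorm_smul,
      Real.enorm_of_nonneg (sum_density_pos hn hf0 x u).le, enorm_inv (by simp; omega)]
    simp
  · refine (ae_eq_condExp_of_forall_setIntegral_eq measurable_fst.comap_le h2
      (fun _ _ _ => (h1.add h3).integrableOn) ?_ ?_).symm
    · rintro _ ⟨A, hA, rfl⟩ -
      have hA' : MeasurableSet ((fun z : Rd d × Rd d => z.1) ⁻¹' A) := measurable_fst hA
      have hAi : ∀ a : Rd d, MeasurableSet ((fun t => a + t) ⁻¹' A) :=
        fun a => (measurable_const_add a) hA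
      have ind : ∀ i, ∀ G : Rd d → Rd d, Integrable (fun t => G (x i + t)) Pξ →
          Integrable (fun t => A.indicator G (x i + t)) Pξ := fun i G hG =>
        hG.indicator (hAi (x i))
      have e1 := integral_smoothedLaw_empiricalMeasure (Pξ := Pξ) x y
        (F := ((fun z : Rd d × Rd d => z.1) ⁻¹' A).indicator
          fun z => z.1 + regression f x y z.1)
        (Measurable.indicator (by fun_prop) hA')
        (fun i => ind i (fun u => u + regression f x y u) ((hadd (x i)).add (hgi i)))
      have e2 := integral_smoothedLaw_empiricalMeasure (Pξ := Pξ) x y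
        (F := ((fun z : Rd d × Rd d => z.1) ⁻¹' A).indicator fun z => z.2)
        (Measurable.indicator (by fun_prop) hA')
        (fun i => (hadd (y i)).indicator (hAi (x i)))
      rw [← integral_indicator hA', ← integral_indicator hA']
      refine e1.trans (Eq.trans ?_ e2.symm)
      congr 1
      -- In the variable `u = x i + t` the second component `y i + t` is `u + (y i - x i)`, so both
      -- sides become Lebesgue integrals over `A` with the same weights.
      have e3 : ∀ i, ∫ t, ((fun z : Rd d × Rd d => z.1) ⁻¹' A).indicator (fun z => z.2)
          (x i + t, y i + t) ∂Pξ =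
          ∫ u, f (u - x i) • A.indicator (fun u => u + (y i - x i)) u := fun i => by
        rw [hPξ, ← integral_withDensity_comp_add_left hf (fun u => (hf0 u).le)]
        refine integral_congr_ae (Filter.Eventually.of_forall fun t => ?_)
        by_cases h : x i + t ∈ A <;> simp [Set.indicator, h]
        abel
      have e4 : ∀ i, ∫ t, ((fun z : Rd d × Rd d => z.1) ⁻¹' A).indicator
          (fun z => z.1 + regression f x y z.1) (x i + t, y i + t) ∂Pξ =
          ∫ u, f (u - x i) • A.indicator (fun u => u + regression f x y u) u := fun i => by
        rw [hPξ, ← integral_withDensity_comp_add_left hf (fun u => (hf0 u).le)]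
        rfl
      simp only [e3, e4]
      rw [← integral_finsetSum, ← integral_finsetSum]
      · refine integral_congr_ae (Filter.Eventually.of_forall fun u => ?_)
        by_cases h : u ∈ A
        · simp only [Set.indicator_of_mem h, smul_add, Finset.sum_add_distrib]
          rw [← Finset.sum_smul, ← Finset.sum_smul, sum_smul_regression hn hf0]
        · simp [h]
      · refine fun i _ => (integrable_withDensity_comp_add_left hf (fun u => (hf0 u).le) (x i)
          (Measurable.indicator (by fun_prop) hA)).1 (ind i _ ?_)
        exact ((hadd (x i)).add (integrable_const (y i - x i)))
      · exact fun i _ => (integrable_withDensity_comp_add_left hf (fun u => (hf0 u).le) (x i)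
          (Measurable.indicator (by fun_prop) hA)).1 (ind i _ ((hadd (x i)).add (hgi i)))
    · refine StronglyMeasurable.aestronglyMeasurable (Measurable.stronglyMeasurable ?_)
      have hm : Measurable[fstAlgebra d] fun z : Rd d × Rd d => z.1 := comap_measurable _
      exact hm.add (hg.comp hm)

lemma measurable_lintegral_smoothed {Ω : Type*} [MeasurableSpace Ω] {f : Rd d → ℝ}
    (hf : Measurable f) {X Y : Fin n → Ω → Rd d} (hX : ∀ i, Measurable (X i))
    (hY : ∀ i, Measurable (Y i)) :
    Measurable fun ω => ∫⁻ u, ‖(n : ℝ)⁻¹ • ∑ i, f (u - X i ω) • (Y i ω - X i ω)‖ₑ :=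
  Measurable.lintegral_prod_right' (f := fun p : Ω × Rd d =>
    ‖(n : ℝ)⁻¹ • ∑ i, f (p.2 - X i p.1) • (Y i p.1 - X i p.1)‖ₑ) (by fun_prop)

end Smoothing

/-! ### The smoothing kernel -/

section Kernel

variable {d : ℕ} {ρ σ : ℝ}

lemma integrable_norm_add_one_rpow (hρ : (d : ℝ) < ρ) :
    Integrable fun x : Rd d => (‖x‖ + 1) ^ (-ρ) := by
  have h := integrable_one_add_norm (E := Rd d) (μ := volume) (r := ρ) (by simpa using hρ)
  simpa only [add_comm] using h

lemma normConst_pos (hρ : (d : ℝ) < ρ) : 0 < normConst d ρ := by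
  have h0 : ∀ x : Rd d, 0 < (‖x‖ + 1) ^ (-ρ) := fun x => by positivity
  refine inv_pos.2 ((integral_pos_iff_support_of_nonneg (fun x => (h0 x).le)
    (integrable_norm_add_one_rpow hρ)).2 ?_)
  rw [Set.eq_univ_of_forall fun x => Function.mem_support.2 (h0 x).ne']
  exact isOpen_univ.measure_pos volume Set.univ_nonempty

lemma kernelDensity_pos (hρ : (d : ℝ) < ρ) (hσ : 0 < σ) (x : Rd d) :
    0 < kernelDensity d ρ σ x := by
  have := normConst_pos hρ
  unfold kernelDensity
  positivity

lemma measurable_kernelDensity : Measurable (kernelDensity d ρ σ) := by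
  unfold kernelDensity
  fun_prop

lemma kernelDensity_le (hρ : (d : ℝ) < ρ) (hσ : 0 < σ) (x : Rd d) :
    kernelDensity d ρ σ x ≤ σ ^ (-(d : ℝ)) * normConst d ρ := by
  have := normConst_pos hρ
  refine mul_le_of_le_one_right (by positivity) ?_
  refine Real.rpow_le_one_of_one_le_of_nonpos ?_ ?_
  · have : 0 ≤ ‖x‖ / σ := by positivity
    linarith
  · have : (0 : ℝ) ≤ d := by positivity
    linarith

/-- The constant is `(r / (2σ))^{-ρ}`: the summand `1` in the kernel is dropped and `‖x‖` replaced
by `r / 2`. -/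
lemma kernelDensity_le_of_le_norm (hρ : (d : ℝ) < ρ) (hσ : 0 < σ) {x : Rd d} {r : ℝ}
    (hr : 0 < r) (hx : r / 2 ≤ ‖x‖) : kernelDensity d ρ σ x ≤
      σ ^ (-(d : ℝ)) * normConst d ρ * (2 ^ ρ * σ ^ ρ * r ^ (-ρ)) := by
  have := normConst_pos hρ
  refine mul_le_mul_of_nonneg_left ?_ (by positivity)
  have h1 : r / (2 * σ) ≤ ‖x‖ / σ + 1 := by
    have : r / (2 * σ) = r / 2 / σ := by field_simp
    have h2 : r / 2 / σ ≤ ‖x‖ / σ := by gcongr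
    linarith
  have h2 : 2 ^ ρ * σ ^ ρ * r ^ (-ρ) = (r / (2 * σ)) ^ (-ρ) := by
    rw [Real.rpow_neg (by positivity), Real.rpow_neg (by positivity),
      Real.div_rpow (by positivity) (by positivity), Real.mul_rpow (by positivity) (by positivity)]
    field_simp
  rw [h2]
  refine Real.rpow_le_rpow_of_nonpos (by positivity) h1 ?_
  have : (0 : ℝ) ≤ d := by positivity
  linarith

lemma integrable_norm_div_add_one_rpow (hρ : (d : ℝ) < ρ) (hσ : 0 < σ) :
    Integrable fun x : Rd d => (‖x‖ / σ + 1) ^ (-ρ) := by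
  have h := (integrable_norm_add_one_rpow hρ).comp_smul (R := σ⁻¹) (by positivity)
  simpa [norm_smul, abs_of_pos hσ, div_eq_inv_mul] using h

lemma integrable_kernelDensity (hρ : (d : ℝ) < ρ) (hσ : 0 < σ) :
    Integrable (kernelDensity d ρ σ) :=
  (integrable_norm_div_add_one_rpow hρ hσ).const_mul _

lemma integral_kernelDensity (hρ : (d : ℝ) < ρ) (hσ : 0 < σ) :
    ∫ x, kernelDensity d ρ σ x = 1 := by
  have h := Measure.integral_comp_inv_smul_of_nonneg (volume : Measure (Rd d))
    (fun x => (‖x‖ + 1) ^ (-ρ)) hσ.le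
  have h1 : ∀ x : Rd d, ‖σ⁻¹ • x‖ = ‖x‖ / σ := fun x => by
    simp [norm_smul, abs_of_pos hσ, div_eq_inv_mul]
  simp only [h1, finrank_euclideanSpace, Fintype.card_fin, smul_eq_mul] at h
  unfold kernelDensity
  rw [integral_const_mul, h, Real.rpow_neg hσ.le, Real.rpow_natCast]
  have hC := (normConst_pos hρ).ne'
  have : ∫ x : Rd d, (‖x‖ + 1) ^ (-ρ) = (normConst d ρ)⁻¹ := by rw [normConst, inv_inv]
  rw [this]
  field_simp

lemma isProbabilityMeasure_kernelLaw (hρ : (d : ℝ) < ρ) (hσ : 0 < σ) :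
    IsProbabilityMeasure (kernelLaw d ρ σ) := by
  refine ⟨?_⟩
  rw [kernelLaw, withDensity_apply _ MeasurableSet.univ, Measure.restrict_univ,
    ← ofReal_integral_eq_lintegral_ofReal (integrable_kernelDensity hρ hσ)
      (Filter.Eventually.of_forall fun x => (kernelDensity_pos hρ hσ x).le),
    integral_kernelDensity hρ hσ, ENNReal.ofReal_one]

/-- One factor `‖x‖` costs one power of decay, hence `ρ - 1 > d`. -/
lemma integrable_id_kernelLaw (hρ : (d : ℝ) + 1 < ρ) (hσ : 0 < σ) :
    Integrable (fun x => x) (kernelLaw d ρ σ) := by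
  have hρ' : (d : ℝ) < ρ := by linarith
  have hC := normConst_pos hρ'
  rw [kernelLaw, integrable_withDensity_iff_integrable_smul'
    measurable_kernelDensity.ennreal_ofReal (by simp)]
  refine ((integrable_norm_div_add_one_rpow (d := d) (ρ := ρ - 1) (by linarith) hσ).const_mul
    (σ ^ (-(d : ℝ)) * normConst d ρ * σ)).mono'
    (measurable_kernelDensity.ennreal_ofReal.ennreal_toReal.smul
      measurable_id).aestronglyMeasurable (Filter.Eventually.of_forall fun x => ?_)
  have hx : 0 ≤ ‖x‖ / σ := by positivity
  rw [ENNReal.toReal_ofReal (kernelDensity_pos hρ' hσ x).le, norm_smul,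
    Real.norm_of_nonneg (kernelDensity_pos hρ' hσ x).le, kernelDensity]
  have h1 : (‖x‖ / σ + 1) ^ (-(ρ - 1)) = (‖x‖ / σ + 1) ^ (-ρ) * (‖x‖ / σ + 1) := by
    rw [← Real.rpow_add_one (by positivity)]; ring_nf
  have h2 : ‖x‖ ≤ σ * (‖x‖ / σ + 1) := by field_simp; linarith
  rw [h1]
  calc _ ≤ σ ^ (-(d : ℝ)) * normConst d ρ * (‖x‖ / σ + 1) ^ (-ρ) * (σ * (‖x‖ / σ + 1)) := by
        gcongr
    _ = _ := by ring

end Kernel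

/-! ### Ball volumes and radial integrals -/

section Volume

/-- The volumes of the Euclidean unit balls are bounded in the dimension. -/
lemma exists_forall_volume_ball_le : ∃ L : ℝ, 0 < L ∧ ∀ d : ℕ, 1 ≤ d →
    volume.real (Metric.ball (0 : Rd d) 1) ≤ L := by
  let a : ℕ → ℝ := fun d => √Real.pi ^ d / Real.Gamma (d / 2 + 1)
  have ha0 : ∀ d, 0 < a d := fun d =>
    div_pos (by positivity) (Real.Gamma_pos_of_pos (by positivity))
  -- The ratio `a (d + 2) / a d` is `π / (d / 2 + 1)`, below `1` once `d ≥ 5`. The dimensions below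
  -- `7` are the base cases, absorbed by a finite sum.
  have hstep : ∀ d, 5 ≤ d → a (d + 2) ≤ a d := fun d hd => by
    have hG : 0 < Real.Gamma ((d : ℝ) / 2 + 1) := Real.Gamma_pos_of_pos (by positivity)
    have hd' : (5 : ℝ) ≤ d := by exact_mod_cast hd
    have h1 : Real.Gamma (((d + 2 : ℕ) : ℝ) / 2 + 1) =
        ((d : ℝ) / 2 + 1) * Real.Gamma ((d : ℝ) / 2 + 1) := by
      rw [← Real.Gamma_add_one (by positivity)]; push_cast; ring_nf
    simp only [a]
    rw [h1, pow_add, Real.sq_sqrt Real.pi_pos.le]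
    refine (div_le_div_iff₀ (by positivity) hG).2 ?_
    have hpi : Real.pi ≤ (d : ℝ) / 2 + 1 := by linarith [Real.pi_lt_d2]
    calc _ = √Real.pi ^ d * Real.Gamma ((d : ℝ) / 2 + 1) * Real.pi := by ring
      _ ≤ √Real.pi ^ d * Real.Gamma ((d : ℝ) / 2 + 1) * ((d : ℝ) / 2 + 1) := by gcongr
      _ = _ := by ring
  have hL : ∀ d, a d ≤ ∑ k ∈ Finset.range 7, a k := by
    intro d
    induction d using Nat.strong_induction_on with
    | _ d ih =>
      by_cases hd : d < 7
      · exact Finset.single_le_sum (fun k _ => (ha0 k).le) (Finset.mem_range.2 hd)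
      · obtain ⟨k, rfl⟩ : ∃ k, d = k + 2 := ⟨d - 2, by omega⟩
        exact (hstep k (by omega)).trans (ih k (by omega))
  refine ⟨∑ k ∈ Finset.range 7, a k, Finset.sum_pos (fun k _ => ha0 k) (by simp), fun d hd => ?_⟩
  have : Nonempty (Fin d) := ⟨⟨0, hd⟩⟩
  rw [measureReal_def, EuclideanSpace.volume_ball]
  simp only [ENNReal.ofReal_one, one_pow, one_mul, Fintype.card_fin]
  rw [ENNReal.toReal_ofReal (ha0 d).le]
  exact hL d

/-- Polar coordinates reduce this to `∫_σ^∞ r^{d-1-a} dr`. -/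
lemma integrable_and_integral_indicator_norm_rpow {d : ℕ} (hd : 1 ≤ d) {a σ : ℝ}
    (ha : (d : ℝ) < a) (hσ : 0 < σ) :
    Integrable (fun x : Rd d => (Set.Ioi σ).indicator (fun r : ℝ => r ^ (-a)) ‖x‖) ∧
    ∫ x : Rd d, (Set.Ioi σ).indicator (fun r : ℝ => r ^ (-a)) ‖x‖ =
      d * volume.real (Metric.ball (0 : Rd d) 1) * (σ ^ ((d : ℝ) - a) / (a - d)) := by
  have : Nonempty (Fin d) := ⟨⟨0, hd⟩⟩
  have hfun : ∀ y : ℝ, y ^ (d - 1) • (Set.Ioi σ).indicator (fun r : ℝ => r ^ (-a)) y =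
      (Set.Ioi σ).indicator (fun r : ℝ => r ^ ((d : ℝ) - 1 - a)) y := fun y => by
    by_cases hy : y ∈ Set.Ioi σ
    · have hy0 : 0 < y := hσ.trans hy
      rw [Set.indicator_of_mem hy, Set.indicator_of_mem hy, smul_eq_mul, ← Real.rpow_natCast,
        ← Real.rpow_add hy0, Nat.cast_sub hd, Nat.cast_one, sub_eq_add_neg _ a]
    · simp [hy]
  have hsub : Set.Ioi (0 : ℝ) ∩ Set.Ioi σ = Set.Ioi σ :=
    Set.inter_eq_right.2 (Set.Ioi_subset_Ioi hσ.le)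
  constructor
  · rw [integrable_fun_norm_addHaar (volume : Measure (Rd d))]
    simp only [finrank_euclideanSpace, Fintype.card_fin, hfun]
    exact ((integrable_indicator_iff measurableSet_Ioi).2
      (integrableOn_Ioi_rpow_of_lt (by linarith) hσ)).integrableOn
  · rw [integral_fun_norm_addHaar (volume : Measure (Rd d))]
    simp only [finrank_euclideanSpace, Fintype.card_fin, hfun]
    rw [setIntegral_indicator measurableSet_Ioi, hsub, integral_Ioi_rpow_of_lt (by linarith) hσ,
      nsmul_eq_mul, smul_eq_mul, ← mul_assoc]
    congr 1
    rw [show (d : ℝ) - 1 - a + 1 = -(a - d) by ring, neg_div_neg_eq]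
    ring_nf

end Volume

/-! ### The radial majorant -/

section Majorant

variable {d : ℕ} {ρ σ p q : ℝ}

/-- A radial majorant of `u ↦ ‖f_{ξ,ρ,σ}(u - X)‖_{2q}`, where `m = E[|X|^{2p}]^{1/(2q)}`. -/
noncomputable def majorant (d : ℕ) (ρ σ p m : ℝ) (u : Rd d) : ℝ :=
  σ ^ (-(d : ℝ)) * normConst d ρ *
    ((Metric.closedBall (0 : Rd d) σ).indicator (fun _ => (1 : ℝ)) u +
      (2 ^ ρ * σ ^ ρ * (Set.Ioi σ).indicator (fun r : ℝ => r ^ (-ρ)) ‖u‖ +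
        m * 2 ^ (p - 1) * (Set.Ioi σ).indicator (fun r : ℝ => r ^ (-(p - 1))) ‖u‖))

lemma integrable_majorant (hd : 1 ≤ d) (hρ : (d : ℝ) < ρ) (hσ : 0 < σ) (hp : (d : ℝ) < p - 1)
    (m : ℝ) : Integrable (majorant d ρ σ p m) := by
  refine Integrable.const_mul (Integrable.add ?_ (Integrable.add ?_ ?_)) _
  · exact (integrable_indicator_iff Metric.isClosed_closedBall.measurableSet).2
      (integrableOn_const (isCompact_closedBall _ _).measure_lt_top.ne)
  · exact (integrable_and_integral_indicator_norm_rpow hd hρ hσ).1.const_mul _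
  · exact (integrable_and_integral_indicator_norm_rpow hd hp hσ).1.const_mul _

lemma integral_majorant (hd : 1 ≤ d) (hρ : (d : ℝ) < ρ) (hσ : 0 < σ) (hp : (d : ℝ) < p - 1)
    (m : ℝ) : ∫ u, majorant d ρ σ p m u =
      volume.real (Metric.ball (0 : Rd d) 1) * (normConst d ρ *
        (d * (m * 2 ^ (p - 1) * (σ ^ (-(p - 1)) / (p - 1 - d)) + 2 ^ ρ * (1 / (ρ - d))) + 1)) := by
  obtain ⟨i1, e1⟩ := integrable_and_integral_indicator_norm_rpow hd hρ hσ
  obtain ⟨i2, e2⟩ := integrable_and_integral_indicator_norm_rpow hd hp hσ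
  have hball := Metric.isClosed_closedBall (x := (0 : Rd d)) (ε := σ)
  have i0 : Integrable ((Metric.closedBall (0 : Rd d) σ).indicator (fun _ => (1 : ℝ))) :=
    (integrable_indicator_iff hball.measurableSet).2
      (integrableOn_const (isCompact_closedBall _ _).measure_lt_top.ne)
  have e0 : ∫ u, (Metric.closedBall (0 : Rd d) σ).indicator (fun _ => (1 : ℝ)) u =
      σ ^ d * volume.real (Metric.ball (0 : Rd d) 1) := by
    rw [integral_indicator hball.measurableSet, setIntegral_const, smul_eq_mul, mul_one,
      Measure.addHaar_real_closedBall _ _ hσ.le, finrank_euclideanSpace, Fintype.card_fin]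
  have i3 : Integrable fun u : Rd d =>
      2 ^ ρ * σ ^ ρ * (Set.Ioi σ).indicator (fun r : ℝ => r ^ (-ρ)) ‖u‖ +
        m * 2 ^ (p - 1) * (Set.Ioi σ).indicator (fun r : ℝ => r ^ (-(p - 1))) ‖u‖ :=
    (i1.const_mul _).add (i2.const_mul _)
  unfold majorant
  rw [integral_const_mul, integral_add i0 i3,
    integral_add (i1.const_mul _) (i2.const_mul _), integral_const_mul, integral_const_mul,
    e0, e1, e2]
  -- The powers of `σ` cancel for the ball and the kernel tail; only the moment tail keeps
  -- `σ^{-(p-1)}`.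
  have h1 : σ ^ (-(d : ℝ)) * σ ^ d = 1 := by
    rw [← Real.rpow_natCast, ← Real.rpow_add hσ]; simp
  have h2 : σ ^ (-(d : ℝ)) * (σ ^ ρ * σ ^ ((d : ℝ) - ρ)) = 1 := by
    rw [← Real.rpow_add hσ, ← Real.rpow_add hσ]; simp
  have h3 : σ ^ (-(d : ℝ)) * σ ^ ((d : ℝ) - (p - 1)) = σ ^ (-(p - 1)) := by
    rw [← Real.rpow_add hσ]; ring_nf
  rw [← h3]
  set w := volume.real (Metric.ball (0 : Rd d) 1)
  linear_combination w * normConst d ρ * h1 +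
    w * normConst d ρ * d * 2 ^ ρ * (1 / (ρ - d)) * h2

lemma majorant_nonneg (hρ : (d : ℝ) < ρ) (hσ : 0 < σ) {m : ℝ} (hm : 0 ≤ m) (u : Rd d) :
    0 ≤ majorant d ρ σ p m u := by
  have hC := normConst_pos hρ
  have h1 : 0 ≤ (Metric.closedBall (0 : Rd d) σ).indicator (fun _ => (1 : ℝ)) u :=
    Set.indicator_nonneg (fun _ _ => zero_le_one) _
  have h2 : ∀ a : ℝ, 0 ≤ (Set.Ioi σ).indicator (fun r : ℝ => r ^ (-a)) ‖u‖ := fun a =>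
    Set.indicator_nonneg (fun r hr => Real.rpow_nonneg (hσ.le.trans (le_of_lt hr)) _) _
  have h3 := h2 ρ
  have h4 := h2 (p - 1)
  unfold majorant
  positivity

/-- The map `t ↦ t^{1/(2q)}` is subadditive because `2q ≥ 1`, and conjugacy turns the exponent `2p /
(2q)` into `p - 1`. -/
lemma rpow_add_mul_rpow_le (hpq : p.HolderConjugate q) {A K M r : ℝ} (hA : 0 ≤ A) (hK : 0 ≤ K)
    (hM : 0 ≤ M) (hr : 0 < r) :
    (A ^ (2 * q) + K ^ (2 * q) * (2 / r) ^ (2 * p) * M) ^ (1 / (2 * q)) ≤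
      A + K * (M ^ (1 / (2 * q)) * 2 ^ (p - 1) * r ^ (-(p - 1))) := by
  have hq1 := hpq.symm.lt
  have hroot : ∀ a : ℝ, 0 ≤ a → (a ^ (2 * q)) ^ (1 / (2 * q)) = a := fun a ha => by
    rw [← Real.rpow_mul ha, mul_one_div_cancel (by linarith), Real.rpow_one]
  have hexp : 2 * p * (1 / (2 * q)) = p - 1 := by
    have := hpq.sub_one_mul_conj
    field_simp
    linarith
  have hpow : ((2 / r) ^ (2 * p)) ^ (1 / (2 * q)) = 2 ^ (p - 1) * r ^ (-(p - 1)) := by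
    rw [← Real.rpow_mul (by positivity), hexp, Real.div_rpow (by positivity) (by positivity),
      Real.rpow_neg hr.le, div_eq_mul_inv]
  have hr1 : 1 / (2 * q) ≤ 1 := (div_le_one (by positivity)).2 (by linarith)
  refine (Real.rpow_add_le_add_rpow (by positivity) (by positivity) (by positivity) hr1).trans
    (le_of_eq ?_)
  rw [Real.mul_rpow (by positivity) hM, Real.mul_rpow (by positivity) (by positivity),
    hroot A hA, hroot K hK, hpow]
  ring

/-- For `‖u‖ ≤ σ` the sup bound on the kernel suffices. Otherwise either `‖X‖ ≤ ‖u‖/2`, and the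
kernel at `u - X` is in its tail, or `‖X‖ > ‖u‖/2`, which is paid for by the `2p`-th moment as in
Markov's inequality. -/
lemma rpow_integral_kernelDensity_le (hρ : (d : ℝ) < ρ) (hσ : 0 < σ) (hpq : p.HolderConjugate q)
    {P : Measure (Rd d × Rd d)} [IsProbabilityMeasure P]
    (hX : MemLp (fun z : Rd d × Rd d => z.1) (ENNReal.ofReal (2 * p)) P) (u : Rd d) :
    (∫ z, kernelDensity d ρ σ (u - z.1) ^ (2 * q) ∂P) ^ (1 / (2 * q)) ≤
      majorant d ρ σ p ((∫ z, ‖z.1‖ ^ (2 * p) ∂P) ^ (1 / (2 * q))) u := by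
  have hp0 := hpq.pos
  have hq0 := hpq.symm.pos
  have hC := normConst_pos hρ
  set K := σ ^ (-(d : ℝ)) * normConst d ρ with hK
  have hK0 : 0 < K := by positivity
  have hf0 : ∀ x, 0 ≤ kernelDensity d ρ σ x := fun x => (kernelDensity_pos hρ hσ x).le
  have hfi : Integrable (fun z : Rd d × Rd d => kernelDensity d ρ σ (u - z.1) ^ (2 * q)) P := by
    refine Integrable.of_bound (C := K ^ (2 * q)) ?_ (Filter.Eventually.of_forall fun z => ?_)
    · exact ((measurable_kernelDensity.comp (by fun_prop)).pow_const _).aestronglyMeasurable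
    · rw [Real.norm_of_nonneg (Real.rpow_nonneg (hf0 _) _)]
      exact Real.rpow_le_rpow (hf0 _) (kernelDensity_le hρ hσ _) (by positivity)
  have hroot : ∀ a : ℝ, 0 ≤ a → (a ^ (2 * q)) ^ (1 / (2 * q)) = a := fun a ha => by
    rw [← Real.rpow_mul ha, mul_one_div_cancel (by positivity), Real.rpow_one]
  by_cases hu : ‖u‖ ≤ σ
  · have e : majorant d ρ σ p ((∫ z, ‖z.1‖ ^ (2 * p) ∂P) ^ (1 / (2 * q))) u = K := by
      have h1 : u ∈ Metric.closedBall (0 : Rd d) σ := by simpa using hu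
      have h2 : ‖u‖ ∉ Set.Ioi σ := by simpa using hu
      simp [majorant, h1, h2, hK]
    rw [e, ← hroot K hK0.le]
    refine Real.rpow_le_rpow (integral_nonneg fun z => Real.rpow_nonneg (hf0 _) _) ?_
      (by positivity)
    calc _ ≤ ∫ _, K ^ (2 * q) ∂P := integral_mono hfi (integrable_const _) fun z =>
          Real.rpow_le_rpow (hf0 _) (kernelDensity_le hρ hσ _) (by positivity)
      _ = _ := by simp
  · push Not at hu
    have hu0 : 0 < ‖u‖ := hσ.trans hu
    set A := K * (2 ^ ρ * σ ^ ρ * ‖u‖ ^ (-ρ)) with hA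
    have hA0 : 0 ≤ A := by positivity
    set M := ∫ z, ‖z.1‖ ^ (2 * p) ∂P with hM
    have hM0 : 0 ≤ M := integral_nonneg fun z => by positivity
    have hMi : Integrable (fun z : Rd d × Rd d => ‖z.1‖ ^ (2 * p)) P := by
      have := hX.integrable_norm_rpow'
      rwa [ENNReal.toReal_ofReal (by positivity)] at this
    have e : majorant d ρ σ p (M ^ (1 / (2 * q))) u =
        A + K * (M ^ (1 / (2 * q)) * 2 ^ (p - 1) * ‖u‖ ^ (-(p - 1))) := by
      have h1 : u ∉ Metric.closedBall (0 : Rd d) σ := by simpa using hu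
      have h2 : ‖u‖ ∈ Set.Ioi σ := hu
      simp only [majorant, Set.indicator_of_notMem h1, Set.indicator_of_mem h2, zero_add]
      ring
    have hpt : ∀ z : Rd d × Rd d, kernelDensity d ρ σ (u - z.1) ^ (2 * q) ≤
        A ^ (2 * q) + K ^ (2 * q) * (2 / ‖u‖) ^ (2 * p) * ‖z.1‖ ^ (2 * p) := fun z => by
      by_cases hz : ‖z.1‖ ≤ ‖u‖ / 2
      · have h1 : ‖u‖ / 2 ≤ ‖u - z.1‖ := by
          have := norm_sub_norm_le u z.1
          linarith
        have h2 := Real.rpow_le_rpow (hf0 _) (kernelDensity_le_of_le_norm hρ hσ hu0 h1)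
          (by positivity : 0 ≤ 2 * q)
        refine h2.trans (le_add_of_nonneg_right (by positivity))
      · push Not at hz
        -- The Markov factor: its `2p`-th power is at least `1` here and integrates to a multiple of
        -- the moment.
        have h1 : 1 ≤ 2 / ‖u‖ * ‖z.1‖ := by
          rw [div_mul_eq_mul_div, one_le_div hu0]; linarith
        have h2 : K ^ (2 * q) ≤ K ^ (2 * q) * (2 / ‖u‖) ^ (2 * p) * ‖z.1‖ ^ (2 * p) := by
          rw [mul_assoc, ← Real.mul_rpow (by positivity) (by positivity)]
          exact le_mul_of_one_le_right (by positivity) (Real.one_le_rpow h1 (by positivity))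
        have h3 := Real.rpow_le_rpow (hf0 _) (kernelDensity_le hρ hσ (u - z.1))
          (by positivity : 0 ≤ 2 * q)
        have h4 : 0 ≤ A ^ (2 * q) := by positivity
        linarith
    have hint : ∫ z, kernelDensity d ρ σ (u - z.1) ^ (2 * q) ∂P ≤
        A ^ (2 * q) + K ^ (2 * q) * (2 / ‖u‖) ^ (2 * p) * M := by
      refine (integral_mono hfi ((integrable_const _).add (hMi.const_mul _)) hpt).trans ?_
      refine (integral_add (integrable_const _) (hMi.const_mul _)).le.trans ?_
      rw [integral_const_mul]
      simp [hM]
    rw [e]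
    exact (Real.rpow_le_rpow (integral_nonneg fun z => Real.rpow_nonneg (hf0 _) _) hint
      (by positivity)).trans (rpow_add_mul_rpow_le hpq hA0 hK0.le hM0 hu0)

end Majorant

/-! ### Averages of centered independent variables -/

section Averages

variable {Ω : Type*} [MeasurableSpace Ω]

lemma lintegral_enorm_average_le {μ : Measure Ω} [IsProbabilityMeasure μ] {n : ℕ} (hn : 1 ≤ n)
    {Z : Fin n → Ω → ℝ} (hZ : ∀ i, MemLp (Z i) 2 μ)
    (hind : Pairwise fun i j => IndepFun (Z i) (Z j) μ) (hmean : ∀ i, ∫ ω, Z i ω ∂μ = 0) {s : ℝ}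
    (hs : 0 ≤ s) (hvar : ∀ i, ∫ ω, Z i ω ^ 2 ∂μ ≤ s ^ 2) :
    ∫⁻ ω, ‖(n : ℝ)⁻¹ * ∑ i, Z i ω‖ₑ ∂μ ≤ ENNReal.ofReal ((n : ℝ) ^ (-(1 / 2) : ℝ) * s) := by
  have hn0 : (0 : ℝ) < n := by exact_mod_cast hn
  have hS : MemLp (∑ i, Z i) 2 μ := memLp_finsetSum' _ fun i _ => hZ i
  have hSabs : MemLp (fun ω => |(∑ i, Z i) ω|) 2 μ := hS.norm
  have hSi : Integrable (∑ i, Z i) μ := hS.integrable (by norm_num)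
  have hmS : ∫ ω, (∑ i, Z i) ω ∂μ = 0 := by
    simp only [Finset.sum_apply]
    rw [integral_finsetSum _ fun i _ => (hZ i).integrable (by norm_num)]
    simp [hmean]
  have hv : ∫ ω, (∑ i, Z i) ω ^ 2 ∂μ ≤ n * s ^ 2 := by
    rw [← variance_of_integral_eq_zero hS.aemeasurable hmS,
      IndepFun.variance_sum (fun i _ => hZ i) (fun i _ j _ hij => hind hij)]
    calc _ ≤ ∑ _i : Fin n, s ^ 2 := Finset.sum_le_sum fun i _ => by
          rw [variance_of_integral_eq_zero (hZ i).aemeasurable (hmean i)]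
          exact hvar i
      _ = _ := by simp
  -- Nonnegativity of the variance of `|S|` gives `(E|S|)² ≤ E S²`, where `S` is the sum.
  have habs : ∫ ω, |(∑ i, Z i) ω| ∂μ ≤ √n * s := by
    have h1 := variance_nonneg (fun ω => |(∑ i, Z i) ω|) μ
    rw [variance_eq_sub hSabs] at h1
    have h2 : ∫ ω, ((fun ω => |(∑ i, Z i) ω|) ^ 2) ω ∂μ = ∫ ω, (∑ i, Z i) ω ^ 2 ∂μ := by
      simp [sq_abs]
    rw [h2] at h1
    refine abs_le_of_sq_le_sq' ?_ (by positivity) |>.2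
    rw [mul_pow, Real.sq_sqrt hn0.le]
    linarith
  have hroot : (n : ℝ)⁻¹ * √n = (n : ℝ) ^ (-(1 / 2) : ℝ) := by
    rw [Real.sqrt_eq_rpow, ← Real.rpow_neg_one, ← Real.rpow_add hn0]
    norm_num
  rw [← hroot, ← ofReal_integral_norm_eq_lintegral_enorm]
  · refine ENNReal.ofReal_le_ofReal ?_
    simp only [norm_mul, norm_inv, Real.norm_natCast, Real.norm_eq_abs (∑ i, Z i _)]
    rw [integral_const_mul, mul_assoc]
    simp only [Finset.sum_apply] at habs
    gcongr
  · simpa using hSi.const_mul (n : ℝ)⁻¹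

end Averages

/-! ### Centering and Hölder's inequality -/

section Moments

variable {d : ℕ} {p q : ℝ} {P : Measure (Rd d × Rd d)}

/-- Conditioning on `X` pulls out `h(X)` and leaves `E[Y - X | X] = 0`; boundedness of `h` secures
integrability. -/
lemma IsMartingaleLaw.integral_smul_eq_zero (hP : IsMartingaleLaw P) {h : Rd d → ℝ}
    (hh : Measurable h) {K : ℝ} (hK : ∀ x, |h x| ≤ K) :
    ∫ z, h z.1 • (z.2 - z.1) ∂P = 0 := by
  have := hP.isProbabilityMeasure
  have i1 := hP.integrable_fst
  have i2 := hP.integrable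
  have hm : Measurable[fstAlgebra d] fun z : Rd d × Rd d => z.1 := comap_measurable _
  have hle : fstAlgebra d ≤ Prod.instMeasurableSpace := measurable_fst.comap_le
  have hi : Integrable ((fun z : Rd d × Rd d => h z.1) • fun z : Rd d × Rd d => z.2 - z.1) P :=
    (i2.sub i1).bdd_smul K (hh.comp measurable_fst).aestronglyMeasurable
      (Filter.Eventually.of_forall fun z => hK _)
  have h1 := condExp_smul_of_aestronglyMeasurable_left
    (hh.comp hm).stronglyMeasurable.aestronglyMeasurable hi (i2.sub i1)
  have h2 : P[fun z : Rd d × Rd d => z.2 - z.1 | fstAlgebra d] =ᵐ[P] 0 := by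
    refine (condExp_sub i2 i1 _).trans ?_
    filter_upwards [hP.condExp_eq] with z hz
    rw [Pi.sub_apply, hz, condExp_of_stronglyMeasurable hle hm.stronglyMeasurable i1]
    simp
  refine (integral_condExp hle (μ := P)
    (f := (fun z : Rd d × Rd d => h z.1) • fun z : Rd d × Rd d => z.2 - z.1)).symm.trans ?_
  refine (integral_congr_ae (h1.trans ?_)).trans (integral_zero _ _)
  filter_upwards [h2] with z hz
  simp [hz]

lemma IsMartingaleLaw.integral_mul_eq_zero (hP : IsMartingaleLaw P) {h : Rd d → ℝ}
    (hh : Measurable h) {K : ℝ} (hK : ∀ x, |h x| ≤ K) (j : Fin d) :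
    ∫ z, h z.1 * (z.2 j - z.1 j) ∂P = 0 := by
  have := hP.isProbabilityMeasure
  have hi : Integrable (fun z : Rd d × Rd d => h z.1 • (z.2 - z.1)) P :=
    (hP.integrable.sub hP.integrable_fst).bdd_smul K
      (hh.comp measurable_fst).aestronglyMeasurable (Filter.Eventually.of_forall fun z => hK _)
  have h1 := (EuclideanSpace.proj (𝕜 := ℝ) j : Rd d →L[ℝ] ℝ).integral_comp_comm hi
  rw [hP.integral_smul_eq_zero hh hK] at h1
  simpa using h1

/-- Hölder with exponents `p`, `q` applied to the squares. -/
lemma integral_mul_sq_le [IsProbabilityMeasure P] (hpq : p.HolderConjugate q) {h : Rd d → ℝ}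
    (hh : Measurable h) {K : ℝ} (hK : ∀ x, |h x| ≤ K) (h0 : ∀ x, 0 ≤ h x)
    {D : Rd d × Rd d → ℝ} (hD : MemLp D (ENNReal.ofReal (2 * p)) P) :
    ∫ z, (h z.1 * D z) ^ 2 ∂P ≤
      ((∫ z, |D z| ^ (2 * p) ∂P) ^ (1 / (2 * p)) *
        (∫ z, h z.1 ^ (2 * q) ∂P) ^ (1 / (2 * q))) ^ 2 := by
  have hp0 := hpq.pos
  have hq0 := hpq.symm.pos
  have e1 : ∀ z, (|D z| ^ 2) ^ p = |D z| ^ (2 * p) := fun z => by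
    rw [← Real.rpow_natCast, ← Real.rpow_mul (abs_nonneg _)]; norm_num
  have e2 : ∀ x, (h x ^ 2) ^ q = h x ^ (2 * q) := fun x => by
    rw [← Real.rpow_natCast, ← Real.rpow_mul (h0 _)]; norm_num
  have hD2 : MemLp (fun z => |D z| ^ 2) (ENNReal.ofReal p) P := by
    have h1 := hD.norm_rpow_div 2
    rw [ENNReal.ofReal_mul (by norm_num)] at h1
    have h2 : ENNReal.ofReal 2 * ENNReal.ofReal p / 2 = ENNReal.ofReal p := by
      rw [mul_comm, ENNReal.ofReal_ofNat]
      exact ENNReal.mul_div_cancel_right (by norm_num) (by norm_num)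
    rw [h2] at h1
    simpa using h1
  have hh2 : MemLp (fun z : Rd d × Rd d => h z.1 ^ 2) (ENNReal.ofReal q) P := by
    refine MemLp.of_bound ((hh.comp measurable_fst).pow_const 2).aestronglyMeasurable (K ^ 2)
       (Filter.Eventually.of_forall fun z => ?_)
    rw [norm_pow, Real.norm_eq_abs]
    exact pow_le_pow_left₀ (abs_nonneg _) (hK _) 2
  have key := integral_mul_le_Lp_mul_Lq_of_nonneg (μ := P) hpq
    (Filter.Eventually.of_forall fun z => sq_nonneg |D z|)
    (Filter.Eventually.of_forall fun z => sq_nonneg (h z.1)) hD2 hh2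
  simp only [e1, e2] at key
  have r : ∀ a : ℝ, 0 ≤ a → ∀ t : ℝ, t ≠ 0 → (a ^ (1 / (2 * t))) ^ 2 = a ^ (1 / t) :=
    fun a ha t ht => by
      rw [← Real.rpow_natCast, ← Real.rpow_mul ha]
      congr 1
      push_cast
      field_simp
  rw [mul_pow, r _ (integral_nonneg fun z => by positivity) p hp0.ne',
    r _ (integral_nonneg fun z => Real.rpow_nonneg (h0 _) _) q hq0.ne']
  refine le_trans (le_of_eq (integral_congr_ae (Filter.Eventually.of_forall fun z => ?_))) key
  simp only [mul_pow, sq_abs]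
  ring

end Moments

/-! ### The expected distance -/

section Expectation

variable {d : ℕ} {ρ σ p q : ℝ}

lemma enorm_le_sum_enorm (v : Rd d) : ‖v‖ₑ ≤ ∑ j, ‖v j‖ₑ := by
  have h := enorm_sum_le Finset.univ
    (fun j => v j • (EuclideanSpace.basisFun (Fin d) ℝ j))
  have hv : ∑ j, v j • EuclideanSpace.basisFun (Fin d) ℝ j = v := by
    simpa using (EuclideanSpace.basisFun (Fin d) ℝ).sum_repr v
  rw [hv] at h
  refine h.trans (Finset.sum_le_sum fun j _ => ?_)
  rw [enorm_smul]
  simp [enorm_eq_nnnorm]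

lemma memLp_sub_apply {r : ℝ≥0∞} {P : Measure (Rd d × Rd d)}
    (hX : MemLp (fun z : Rd d × Rd d => z.1) r P) (hY : MemLp (fun z : Rd d × Rd d => z.2) r P)
    (j : Fin d) : MemLp (fun z : Rd d × Rd d => z.2 j - z.1 j) r P := by
  refine (hY.sub hX).mono (Measurable.aestronglyMeasurable (by fun_prop))
    (Filter.Eventually.of_forall fun z => ?_)
  exact PiLp.norm_apply_le (z.2 - z.1) j

lemma lintegral_enorm_average_kernelDensity_le (hρ : (d : ℝ) < ρ) (hσ : 0 < σ)
    (hpq : p.HolderConjugate q) {P₀ : Measure (Rd d × Rd d)} (hP : IsMartingaleLaw P₀)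
    (hX₀ : MemLp (fun z : Rd d × Rd d => z.1) (ENNReal.ofReal (2 * p)) P₀)
    (hY₀ : MemLp (fun z : Rd d × Rd d => z.2) (ENNReal.ofReal (2 * p)) P₀) {n : ℕ} (hn : 1 ≤ n)
    {Ω : Type*} [MeasurableSpace Ω] {μ : Measure Ω} [IsProbabilityMeasure μ]
    {X Y : Fin n → Ω → Rd d} (hX : ∀ i, Measurable (X i)) (hY : ∀ i, Measurable (Y i))
    (hind : iIndepFun (fun i ω => (X i ω, Y i ω)) μ)
    (hlaw : ∀ i, μ.map (fun ω => (X i ω, Y i ω)) = P₀) (u : Rd d) (j : Fin d) :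
    ∫⁻ ω, ‖(n : ℝ)⁻¹ * ∑ i, kernelDensity d ρ σ (u - X i ω) * (Y i ω j - X i ω j)‖ₑ ∂μ ≤
      ENNReal.ofReal ((n : ℝ) ^ (-(1 / 2) : ℝ) *
        ((∫ z, |z.1 j - z.2 j| ^ (2 * p) ∂P₀) ^ (1 / (2 * p)) *
          majorant d ρ σ p ((∫ z, ‖z.1‖ ^ (2 * p) ∂P₀) ^ (1 / (2 * q))) u)) := by
  have := hP.isProbabilityMeasure
  have hp1 := hpq.lt
  have hq0 := hpq.symm.pos
  have hf0 : ∀ x, 0 ≤ kernelDensity d ρ σ x := fun x => (kernelDensity_pos hρ hσ x).le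
  let h : Rd d → ℝ := fun x => kernelDensity d ρ σ (u - x)
  have hh : Measurable h := measurable_kernelDensity.comp (by fun_prop)
  have hK : ∀ x, |h x| ≤ σ ^ (-(d : ℝ)) * normConst d ρ := fun x => by
    rw [abs_of_nonneg (hf0 _)]
    exact kernelDensity_le hρ hσ _
  let Z : Rd d × Rd d → ℝ := fun z => h z.1 * (z.2 j - z.1 j)
  have hZm : Measurable Z := by fun_prop
  have hD := memLp_sub_apply hX₀ hY₀ j
  have hZ : MemLp Z 2 P₀ := by
    have h1 : MemLp Z (ENNReal.ofReal (2 * p)) P₀ := by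
      refine hD.of_le_mul (c := σ ^ (-(d : ℝ)) * normConst d ρ) hZm.aestronglyMeasurable
        (Filter.Eventually.of_forall fun z => ?_)
      rw [norm_mul]
      exact mul_le_mul_of_nonneg_right (hK _) (norm_nonneg _)
    refine h1.mono_exponent ?_
    rw [← ENNReal.ofReal_ofNat]
    exact ENNReal.ofReal_le_ofReal (by linarith)
  have hT : ∀ i, Measurable fun ω => (X i ω, Y i ω) := fun i => (hX i).prodMk (hY i)
  refine (lintegral_enorm_average_le (Z := fun i ω => Z (X i ω, Y i ω)) hn (fun i => ?_)
    (fun i k hik => (hind.indepFun hik).comp hZm hZm) (fun i => ?_)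
    (s := (∫ z, |z.2 j - z.1 j| ^ (2 * p) ∂P₀) ^ (1 / (2 * p)) *
      (∫ z, h z.1 ^ (2 * q) ∂P₀) ^ (1 / (2 * q))) ?_ fun i => ?_).trans ?_
  · rw [← hlaw i] at hZ
    exact (memLp_map_measure_iff hZm.aestronglyMeasurable (hT i).aemeasurable).1 hZ
  · have h0 := hP.integral_mul_eq_zero hh hK j
    rw [← hlaw i, integral_map (hT i).aemeasurable hZm.aestronglyMeasurable] at h0
    exact h0
  · exact mul_nonneg (Real.rpow_nonneg (integral_nonneg fun z => by positivity) _)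
      (Real.rpow_nonneg (integral_nonneg fun z => Real.rpow_nonneg (hf0 _) _) _)
  · have h0 := integral_mul_sq_le hpq hh hK (fun x => hf0 _) hD
    nth_rewrite 1 [← hlaw i] at h0
    rw [integral_map (hT i).aemeasurable (hZm.pow_const 2).aestronglyMeasurable] at h0
    exact h0
  · simp only [abs_sub_comm (_ : ℝ) ((_ : Rd d × Rd d).1 j)]
    refine ENNReal.ofReal_le_ofReal ?_
    refine mul_le_mul_of_nonneg_left (mul_le_mul_of_nonneg_left
      (rpow_integral_kernelDensity_le hρ hσ hpq hX₀ u) ?_) (by positivity)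
    exact Real.rpow_nonneg (integral_nonneg fun z => by positivity) _

/-- Tonelli puts the expectation inside the `u`-integral, where the `n^{-1/2}` bound holds pointwise
and coordinatewise; the majorant then makes the result integrable in `u`. -/
theorem lintegral_smoothedMPD_empiricalMeasure_le (hd : 1 ≤ d) (hρ : (d : ℝ) + 1 < ρ)
    (hσ : 0 < σ) (hp : (d : ℝ) + 1 < p) (hpq : p.HolderConjugate q)
    {P₀ : Measure (Rd d × Rd d)} (hP : IsMartingaleLaw P₀)
    (hX₀ : MemLp (fun z : Rd d × Rd d => z.1) (ENNReal.ofReal (2 * p)) P₀)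
    (hY₀ : MemLp (fun z : Rd d × Rd d => z.2) (ENNReal.ofReal (2 * p)) P₀) {n : ℕ} (hn : 1 ≤ n)
    {Ω : Type*} [MeasurableSpace Ω] {μ : Measure Ω} [IsProbabilityMeasure μ]
    {X Y : Fin n → Ω → Rd d} (hX : ∀ i, Measurable (X i)) (hY : ∀ i, Measurable (Y i))
    (hind : iIndepFun (fun i ω => (X i ω, Y i ω)) μ)
    (hlaw : ∀ i, μ.map (fun ω => (X i ω, Y i ω)) = P₀) :
    ∫⁻ ω, (∫⁻ u, ‖(n : ℝ)⁻¹ • ∑ i, kernelDensity d ρ σ (u - X i ω) • (Y i ω - X i ω)‖ₑ) ∂μ ≤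
      ENNReal.ofReal ((n : ℝ) ^ (-(1 / 2) : ℝ) *
        ((∑ j, (∫ z, |z.1 j - z.2 j| ^ (2 * p) ∂P₀) ^ (1 / (2 * p))) *
          ∫ u, majorant d ρ σ p ((∫ z, ‖z.1‖ ^ (2 * p) ∂P₀) ^ (1 / (2 * q))) u)) := by
  have hρ' : (d : ℝ) < ρ := by linarith
  have hf := measurable_kernelDensity (d := d) (ρ := ρ) (σ := σ)
  set a : Fin d → ℝ := fun j => (∫ z, |z.1 j - z.2 j| ^ (2 * p) ∂P₀) ^ (1 / (2 * p)) with ha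
  have ha0 : ∀ j, 0 ≤ a j := fun j =>
    Real.rpow_nonneg (integral_nonneg fun z => by positivity) _
  set m := (∫ z, ‖z.1‖ ^ (2 * p) ∂P₀) ^ (1 / (2 * q)) with hm
  have hm0 : 0 ≤ m := Real.rpow_nonneg (integral_nonneg fun z => by positivity) _
  have hmaj0 := majorant_nonneg (p := p) hρ' hσ hm0
  have hmaji := integrable_majorant hd hρ' hσ (p := p) (by linarith) m
  rw [lintegral_lintegral_swap (Measurable.aemeasurable (by fun_prop))]
  calc ∫⁻ u, ∫⁻ ω, ‖(n : ℝ)⁻¹ • ∑ i, kernelDensity d ρ σ (u - X i ω) • (Y i ω - X i ω)‖ₑ ∂μ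
      ≤ ∫⁻ u, ∑ j, ∫⁻ ω,
          ‖(n : ℝ)⁻¹ * ∑ i, kernelDensity d ρ σ (u - X i ω) * (Y i ω j - X i ω j)‖ₑ ∂μ := by
        refine lintegral_mono fun u => ?_
        rw [← lintegral_finsetSum _ fun j _ => by fun_prop]
        refine lintegral_mono fun ω => (enorm_le_sum_enorm _).trans (le_of_eq ?_)
        simp
    _ ≤ ∫⁻ u, ENNReal.ofReal ((n : ℝ) ^ (-(1 / 2) : ℝ) * (∑ j, a j) *
          majorant d ρ σ p m u) := by
        refine lintegral_mono fun u => (Finset.sum_le_sum fun j _ =>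
          lintegral_enorm_average_kernelDensity_le hρ' hσ hpq hP hX₀ hY₀ hn hX hY hind hlaw u
            j).trans (le_of_eq ?_)
        rw [← ENNReal.ofReal_sum_of_nonneg fun j _ =>
          mul_nonneg (by positivity) (mul_nonneg (ha0 j) (hmaj0 u)), ← Finset.mul_sum,
          ← Finset.sum_mul, mul_assoc]
    _ = _ := by
        rw [← ofReal_integral_eq_lintegral_ofReal (hmaji.const_mul _)
          (Filter.Eventually.of_forall fun u => mul_nonneg (mul_nonneg (by positivity)
            (Finset.sum_nonneg fun j _ => ha0 j)) (hmaj0 u)), integral_const_mul, mul_assoc]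

end Expectation

end MartProj

/-! ### Comparison with the stated constant -/

theorem mainTheorem7 :
    ∃ L : ℝ, 0 < L ∧
      ∀ (d : ℕ), 1 ≤ d →
      ∀ (ρ σ p q : ℝ), (d : ℝ) + 1 < ρ → 0 < σ → (d : ℝ) + 1 < p → p.HolderConjugate q →
      ∀ P₀ : Measure (MartProj.Rd d × MartProj.Rd d), MartProj.IsMartingaleLaw P₀ →
        MemLp (fun z : MartProj.Rd d × MartProj.Rd d => z.1) (ENNReal.ofReal (2 * p)) P₀ →
        MemLp (fun z : MartProj.Rd d × MartProj.Rd d => z.2) (ENNReal.ofReal (2 * p)) P₀ →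
      ∀ (n : ℕ), 1 ≤ n →
      ∀ (Ω : Type*) [MeasurableSpace Ω] (μ : Measure Ω) [IsProbabilityMeasure μ]
        (X Y : Fin n → Ω → MartProj.Rd d),
        (∀ i, Measurable (X i)) → (∀ i, Measurable (Y i)) →
        iIndepFun (fun i ω => (X i ω, Y i ω)) μ →
        (∀ i, μ.map (fun ω => (X i ω, Y i ω)) = P₀) →
        Measurable (fun ω => MartProj.smoothedMPD (MartProj.kernelLaw d ρ σ)
          (MartProj.empiricalMeasure (fun i => X i ω) (fun i => Y i ω)) 1) ∧
        ∫⁻ ω, MartProj.smoothedMPD (MartProj.kernelLaw d ρ σ)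
          (MartProj.empiricalMeasure (fun i => X i ω) (fun i => Y i ω)) 1 ∂μ
        ≤ ENNReal.ofReal (L * (n : ℝ) ^ (-(1 / 2) : ℝ) *
            ∑ j : Fin d, (∫ z, |z.1 j - z.2 j| ^ (2 * p) ∂P₀) ^ (1 / (2 * p)) *
              MartProj.normConst d ρ *
              ((d : ℝ) ^ (3 / 2 : ℝ) * ρ *
                  ((∫ z, ‖z.1‖ ^ (2 * p) ∂P₀) ^ (1 / (2 * q)) * 2 ^ (p - 1)
                      * (σ ^ (-p) / (p - 1 - d))
                    + 2 ^ (ρ + 1) * (σ ^ (-1 : ℝ) / (ρ + 1 - d)))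
                + d *
                  ((∫ z, ‖z.1‖ ^ (2 * p) ∂P₀) ^ (1 / (2 * q)) * 2 ^ (p - 1)
                      * (σ ^ (-(p - 1)) / (p - 1 - d))
                    + 2 ^ ρ * (1 / (ρ - d)))
                + (√(d : ℝ) * ρ * σ ^ (-((d : ℝ) + 1)) + σ ^ (-(d : ℝ))) * (σ ^ d + 1))) := by
  obtain ⟨L, hL, hball⟩ := MartProj.exists_forall_volume_ball_le
  refine ⟨L, hL, fun d hd ρ σ p q hρ hσ hp hpq P₀ hP hX₀ hY₀ n hn Ω _ μ _ X Y hX hY hind hlaw => ?_⟩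
  have hρ' : (d : ℝ) < ρ := by linarith
  have hprob := MartProj.isProbabilityMeasure_kernelLaw hρ' hσ
  have hfm := MartProj.measurable_kernelDensity (d := d) (ρ := ρ) (σ := σ)
  have hformula : ∀ ω, MartProj.smoothedMPD (MartProj.kernelLaw d ρ σ)
      (MartProj.empiricalMeasure (fun i => X i ω) (fun i => Y i ω)) 1 =
      ∫⁻ u, ‖(n : ℝ)⁻¹ • ∑ i, MartProj.kernelDensity d ρ σ (u - X i ω) • (Y i ω - X i ω)‖ₑ :=
    fun ω => MartProj.smoothedMPD_empiricalMeasure hn hfm (MartProj.kernelDensity_pos hρ' hσ)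
      (hp := hprob) (MartProj.integrable_id_kernelLaw hρ hσ) _ _
  simp only [hformula]
  refine ⟨MartProj.measurable_lintegral_smoothed hfm hX hY,
    (MartProj.lintegral_smoothedMPD_empiricalMeasure_le hd hρ hσ hp hpq hP hX₀ hY₀ hn hX hY hind
      hlaw).trans (ENNReal.ofReal_le_ofReal ?_)⟩
  have hC := MartProj.normConst_pos hρ'
  have hd0 : (0 : ℝ) ≤ d := by positivity
  have hρ0 : 0 < ρ := by linarith
  have hρ1 : 0 < ρ + 1 - d := by linarith
  have hρ2 : 0 < ρ - d := by linarith
  have hp2 : 0 < p - 1 - d := by linarith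
  have hm0 : 0 ≤ (∫ z, ‖z.1‖ ^ (2 * p) ∂P₀) ^ (1 / (2 * q)) :=
    Real.rpow_nonneg (integral_nonneg fun z => by positivity) _
  have ha0 : 0 ≤ ∑ j, (∫ z, |z.1 j - z.2 j| ^ (2 * p) ∂P₀) ^ (1 / (2 * p)) :=
    Finset.sum_nonneg fun j _ => Real.rpow_nonneg (integral_nonneg fun z => by positivity) _
  rw [MartProj.integral_majorant hd hρ' hσ (by linarith), ← Finset.sum_mul, ← Finset.sum_mul]
  generalize (∫ z, ‖z.1‖ ^ (2 * p) ∂P₀) ^ (1 / (2 * q)) = m at hm0 ⊢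
  generalize ∑ j, (∫ z, |z.1 j - z.2 j| ^ (2 * p) ∂P₀) ^ (1 / (2 * p)) = a at ha0 ⊢
  -- The ball `‖u‖ ≤ σ` contributes the summand `1`, dominated by the product `σ^{-d} σ^d` inside
  -- the last group.
  have hone : 1 ≤ (√(d : ℝ) * ρ * σ ^ (-((d : ℝ) + 1)) + σ ^ (-(d : ℝ))) * (σ ^ d + 1) := by
    have h1 : σ ^ (-(d : ℝ)) * σ ^ d = 1 := by
      rw [← Real.rpow_natCast, ← Real.rpow_add hσ]; simp
    have h2 : 0 ≤ √(d : ℝ) * ρ * σ ^ (-((d : ℝ) + 1)) * (σ ^ d + 1) := by positivity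
    have h3 : 0 ≤ σ ^ (-(d : ℝ)) := by positivity
    linarith
  -- The derivative-type group is not needed for the estimate: it is nonnegative and only enlarges
  -- the right-hand side.
  have hfirst : 0 ≤ (d : ℝ) ^ (3 / 2 : ℝ) * ρ * (m * 2 ^ (p - 1) * (σ ^ (-p) / (p - 1 - d))
      + 2 ^ (ρ + 1) * (σ ^ (-1 : ℝ) / (ρ + 1 - d))) := by positivity
  calc _ = volume.real (Metric.ball (0 : MartProj.Rd d) 1) *
        ((n : ℝ) ^ (-(1 / 2) : ℝ) * (a * MartProj.normConst d ρ *
          (d * (m * 2 ^ (p - 1) * (σ ^ (-(p - 1)) / (p - 1 - d)) + 2 ^ ρ * (1 / (ρ - d))) + 1))) := by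
        ring
    _ ≤ L * ((n : ℝ) ^ (-(1 / 2) : ℝ) * (a * MartProj.normConst d ρ *
          (d * (m * 2 ^ (p - 1) * (σ ^ (-(p - 1)) / (p - 1 - d)) + 2 ^ ρ * (1 / (ρ - d))) + 1))) :=
        mul_le_mul_of_nonneg_right (hball d hd) (by positivity)
    _ ≤ _ := by
        rw [← mul_assoc L]
        refine mul_le_mul_of_nonneg_left (mul_le_mul_of_nonneg_left ?_ (by positivity))
          (by positivity)
        linarith
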